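/- Let $n\ge 1$. A configuration is a perfect matching of the $2n$ points $1,\dots,2n$ on a line into $n$ pairs, together with one marked pair (the given pair); there are $n\,(2n-1)!!$ configurations, taken to be equally likely. Another pair is excluded by the given pair $\{a<b\}$ if both of its endpoints are less than $a$ or both are greater than $b$. Let $X_{n,p}$ be the number of configurations in which exactly $p$ pairs are excluded by the given pair, and let $\mathcal X_n(p)=X_{n,p}/\bigl(n\,(2n-1)!!\bigr)$ be the corresponding probability. Define, for $x\in[0,1]$, $$\mathcal X(x)=\begin{cases}\pi/2, & 0\le x<1/2,\\ \pi/2-2\tan^{-1}\sqrt{2x-1}, & 1/2\le x\le 1.\end{cases}$$ Then $\mathcal X$ is the asymptotic distribution of the number of excluded pairs, that is: 1. for every $x\in[0,1]$ and every sequence of integers $p_n\ge 0$ with $p_n/(n-1)\to x$, $$\lim_{n\to\infty}(n-1)\,\mathcal X_n(p_n)=\mathcal X(x);$$ 2. for every $x\in[0,1]$, $$\lim_{n\to\infty}\ \sum_{0\le p\le (n-1)x}\mathcal X_n(p)=\int_0^x\mathcal X(t)\,dt .$$ In particular, the probability that fewer than half of the $n-1$ other pairs are excluded, $\sum_{0\le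 p<(n-1)/2}\mathcal X_n(p)$, tends to $\pi/4$ as $n\to\infty$. -/

import Mathlib

/-- A linear chord diagram on the `2 * n` vertices `0 < 1 < ⋯ < 2 * n - 1`: a perfect matching of
the vertices, given as the fixed-point-free involution that sends each vertex to its partner. -/
def IsChordDiagram {n : ℕ} (σ : Equiv.Perm (Fin (2 * n))) : Prop :=
  ∀ i, σ (σ i) = i ∧ σ i ≠ i

instance {n : ℕ} (σ : Equiv.Perm (Fin (2 * n))) : Decidable (IsChordDiagram σ) :=
  inferInstanceAs (Decidable (∀ i, σ (σ i) = i ∧ σ i ≠ i))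

/-- The left endpoints of the chords; they index the pairs `{i, σ i}` of the diagram. -/
def leftEndpoints {n : ℕ} (σ : Equiv.Perm (Fin (2 * n))) : Finset (Fin (2 * n)) :=
  Finset.univ.filter fun i => i < σ i

/-- Configurations of `n` pairs with one given (marked) pair: a chord diagram together with the
left endpoint of the marked chord. -/
def configurations (n : ℕ) : Finset (Equiv.Perm (Fin (2 * n)) × Fin (2 * n)) :=
  Finset.univ.filter fun c => IsChordDiagram c.1 ∧ c.2 ∈ leftEndpoints c.1

/-- The pairs (indexed by left endpoints `j`) excluded by the pair `{i, σ i}`, where `i < σ i`: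
both endpoints are to the left of `i`, or both are to the right of `σ i`. -/
def excludedPairs {n : ℕ} (σ : Equiv.Perm (Fin (2 * n))) (i : Fin (2 * n)) :
    Finset (Fin (2 * n)) :=
  (leftEndpoints σ).filter fun j => (j < i ∧ σ j < i) ∨ (σ i < j ∧ σ i < σ j)

/-- `X_{n,p}`: the number of configurations in which exactly `p` pairs are excluded by the
given pair. -/
def excludedCount (n p : ℕ) : ℕ :=
  ((configurations n).filter fun c => (excludedPairs c.1 c.2).card = p).card

/-- `𝒳_n(p) = X_{n,p} / (n (2n-1)!!)`: the probability that exactly `p` pairs are excluded, all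
`n (2n-1)!!` configurations being equally likely (`n ≥ 1`). -/
noncomputable def excludedProb (n p : ℕ) : ℝ :=
  (excludedCount n p : ℝ) / ((n : ℝ) * (Nat.doubleFactorial (2 * n - 1) : ℝ))

/-- The limiting density `𝒳(x)`, for `x ∈ [0, 1]`. -/
noncomputable def excludedDensity (x : ℝ) : ℝ :=
  if x < 1 / 2 then Real.pi / 2 else Real.pi / 2 - 2 * Real.arctan (Real.sqrt (2 * x - 1))

/-!
Place the `2n` endpoints at independent uniform positions in `[0, 1]`. Which pairs are excluded
depends only on the relative order of the positions, and relabelling by ranks turns any fixed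
matching of the random points into a uniformly random configuration. If the endpoints of the given
pair sit at `a < b`, each of the other `m = n - 1` pairs is excluded, independently, with
probability `a² + (1 - b)²`. Hence `𝒳_n` is a mixture of binomial laws whose parameter is
distributed as `a² + (1 - b)²`. In the coordinates `(a, 1 - b)`, uniform on the simplex `u, v ≥ 0`,
`u + v ≤ 1`, this parameter is the squared distance to the origin, so its density at `t` is the
angle of the circle of radius `√t` contained in the simplex, which is `𝒳(t)`:

  `𝒳_n(p) = ∫₀¹ (m choose p) tᵖ (1 - t)ᵐ⁻ᵖ 𝒳(t) dt`.

Multiplied by `m + 1`, the Bernstein polynomial in this formula is a beta density whose second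
moment about `x` tends to `0` as `p / m → x`. This gives the local limit, and the limit of the
distribution functions follows by dominated convergence.
-/

open MeasureTheory Set Filter Topology
open scoped Finset

/-! ### Chord diagrams and positions on a line -/

/-- The labels `k` whose pair `{k, σ k}` lies entirely below or entirely above the pair `{i, σ i}`
when the labels are placed on a line at the positions `x`. -/
def exclusionSet {ι α : Type*} [Fintype ι] [LinearOrder α] (σ : Equiv.Perm ι) (i : ι)
    (x : ι → α) : Finset ι :=
  {k | max (x k) (x (σ k)) < min (x i) (x (σ i)) ∨ max (x i) (x (σ i)) < min (x k) (x (σ k))}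

section exclusionSet

variable {ι κ α β : Type*} [Fintype ι] [Fintype κ] [LinearOrder α] [LinearOrder β]

theorem mem_exclusionSet {σ : Equiv.Perm ι} {i k : ι} {x : ι → α} :
    k ∈ exclusionSet σ i x ↔
      max (x k) (x (σ k)) < min (x i) (x (σ i)) ∨ max (x i) (x (σ i)) < min (x k) (x (σ k)) := by
  simp [exclusionSet]

theorem exclusionSet_congr {x : ι → α} {y : ι → β} (h : ∀ k l, x k < x l ↔ y k < y l)
    (σ : Equiv.Perm ι) (i : ι) : exclusionSet σ i x = exclusionSet σ i y := by
  simp only [exclusionSet, max_lt_iff, lt_min_iff, h]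

theorem card_exclusionSet_permCongr (e : ι ≃ κ) (σ : Equiv.Perm ι) (i : ι) (x : κ → α) :
    #(exclusionSet (e.permCongr σ) (e i) x) = #(exclusionSet σ i (x ∘ e)) := by
  refine (Finset.card_equiv e fun k => ?_).symm
  simp [mem_exclusionSet]

end exclusionSet

namespace IsChordDiagram

variable {n : ℕ} {σ : Equiv.Perm (Fin (2 * n))}

theorem card_eq_two_mul_card_filter_lt (h : IsChordDiagram σ) {s : Finset (Fin (2 * n))}
    (hs : ∀ k ∈ s, σ k ∈ s) : #s = 2 * #{k ∈ s | k < σ k} := by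
  have hswap : #{k ∈ s | ¬ k < σ k} = #{k ∈ s | k < σ k} := by
    refine Finset.card_bij' (fun k _ => σ k) (fun k _ => σ k) ?_ ?_
      (fun k _ => (h k).1) (fun k _ => (h k).1)
    · intro k hk
      rw [Finset.mem_filter, (h k).1] at *
      exact ⟨hs k hk.1, (not_lt.1 hk.2).lt_of_ne (h k).2⟩
    · intro k hk
      rw [Finset.mem_filter, (h k).1] at *
      exact ⟨hs k hk.1, hk.2.not_gt⟩
  have hsplit := Finset.card_filter_add_card_filter_not (s := s) (fun k => k < σ k)
  lia

theorem apply_mem_exclusionSet {α : Type*} [LinearOrder α] (h : IsChordDiagram σ)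
    {i k : Fin (2 * n)} {x : Fin (2 * n) → α} (hk : k ∈ exclusionSet σ i x) :
    σ k ∈ exclusionSet σ i x := by
  rw [mem_exclusionSet] at *
  rwa [(h k).1, max_comm (x (σ k)), min_comm (x (σ k))]

theorem exclusionSet_apply {α : Type*} [LinearOrder α] (h : IsChordDiagram σ) (i : Fin (2 * n))
    (x : Fin (2 * n) → α) : exclusionSet σ (σ i) x = exclusionSet σ i x := by
  ext k
  rw [mem_exclusionSet, mem_exclusionSet, (h i).1, max_comm (x (σ i)), min_comm (x (σ i))]

theorem card_exclusionSet_id (h : IsChordDiagram σ) {i : Fin (2 * n)} (hi : i < σ i) :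
    #(exclusionSet σ i id) = 2 * #(excludedPairs σ i) := by
  rw [h.card_eq_two_mul_card_filter_lt fun k => h.apply_mem_exclusionSet]
  congr 2
  ext k
  simp only [excludedPairs, leftEndpoints, Finset.mem_filter, Finset.mem_univ, true_and,
    mem_exclusionSet, id, max_eq_right hi.le, min_eq_left hi.le, max_lt_iff, lt_min_iff, and_comm]

theorem card_filter_exclusionSet_id (h : IsChordDiagram σ) (p : ℕ) :
    #{i | #(exclusionSet σ i id) = 2 * p} =
      2 * #{i ∈ leftEndpoints σ | #(excludedPairs σ i) = p} := by
  rw [h.card_eq_two_mul_card_filter_lt fun i => by simp [h.exclusionSet_apply],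
    leftEndpoints, Finset.filter_comm]
  congr 2
  refine Finset.filter_congr fun i hi => ?_
  rw [h.card_exclusionSet_id (Finset.mem_filter.1 hi).2, mul_right_inj' two_ne_zero]

theorem permCongr_iff (g : Equiv.Perm (Fin (2 * n))) :
    IsChordDiagram (g.permCongr σ) ↔ IsChordDiagram σ := by
  refine g.symm.forall_congr fun i => ?_
  simp [← Equiv.eq_symm_apply]

end IsChordDiagram

theorem card_filter_exclusionSet_id (n p : ℕ) :
    #{c : Equiv.Perm (Fin (2 * n)) × Fin (2 * n) |
      IsChordDiagram c.1 ∧ #(exclusionSet c.1 c.2 id) = 2 * p} = 2 * excludedCount n p := by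
  have hfiber : ∀ P : Equiv.Perm (Fin (2 * n)) × Fin (2 * n) → Prop, ∀ [DecidablePred P],
      #{c | IsChordDiagram c.1 ∧ P c} = ∑ σ with IsChordDiagram σ, #{i | P (σ, i)} := by
    intro P _
    rw [Finset.card_filter, Fintype.sum_prod_type, Finset.sum_filter]
    refine Finset.sum_congr rfl fun σ _ => ?_
    by_cases h : IsChordDiagram σ <;> simp [h]
  simp only [excludedCount, configurations, Finset.filter_filter, and_assoc]
  rw [hfiber, hfiber, Finset.mul_sum]
  refine Finset.sum_congr rfl fun σ hσ => ?_
  simp only [(Finset.mem_filter.1 hσ).2.card_filter_exclusionSet_id, ← Finset.filter_filter,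
    Finset.filter_univ_mem]

theorem exists_perm_lt_iff_lt {N : ℕ} {α : Type*} [LinearOrder α] {x : Fin N → α}
    (hx : Function.Injective x) : ∃ g : Equiv.Perm (Fin N), ∀ k l, x k < x l ↔ g k < g l := by
  have hmono : StrictMono (x ∘ Tuple.sort x) :=
    (Tuple.monotone_sort x).strictMono_of_injective (hx.comp (Tuple.sort x).injective)
  refine ⟨(Tuple.sort x)⁻¹, fun k l => ?_⟩
  simpa using hmono.lt_iff_lt (a := (Tuple.sort x)⁻¹ k) (b := (Tuple.sort x)⁻¹ l)

theorem card_filter_exclusionSet {n : ℕ} {α : Type*} [LinearOrder α] {x : Fin (2 * n) → α}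
    (hx : Function.Injective x) (p : ℕ) :
    #{c : Equiv.Perm (Fin (2 * n)) × Fin (2 * n) |
      IsChordDiagram c.1 ∧ #(exclusionSet c.1 c.2 x) = 2 * p} = 2 * excludedCount n p := by
  obtain ⟨g, hg⟩ := exists_perm_lt_iff_lt hx
  rw [← card_filter_exclusionSet_id]
  refine Finset.card_equiv (g.permCongr.prodCongr g) fun ⟨σ, i⟩ => ?_
  have hid : exclusionSet σ i x = exclusionSet σ i (id ∘ g) := exclusionSet_congr hg σ i
  simp only [Finset.mem_filter_univ, Equiv.prodCongr_apply, Prod.map_apply,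
    IsChordDiagram.permCongr_iff, card_exclusionSet_permCongr, hid]

theorem isChordDiagram_iff_pow_two {n : ℕ} {σ : Equiv.Perm (Fin (2 * n))} :
    IsChordDiagram σ ↔ σ ^ 2 = 1 ∧ #σ.support = 2 * n := by
  have hsupport : #σ.support = 2 * n ↔ ∀ i, σ i ≠ i := by
    simpa [Finset.eq_univ_iff_forall] using Finset.card_eq_iff_eq_univ σ.support
  rw [hsupport, IsChordDiagram, forall_and, pow_two, Equiv.Perm.ext_iff]
  rfl

theorem isChordDiagram_iff_cycleType {n : ℕ} {σ : Equiv.Perm (Fin (2 * n))} :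
    IsChordDiagram σ ↔ σ.cycleType = Multiset.replicate n 2 := by
  rw [isChordDiagram_iff_pow_two, Equiv.Perm.pow_prime_eq_one_iff, Multiset.eq_replicate, and_comm,
    and_congr_left_iff]
  intro h
  rw [← σ.sum_cycleType, Multiset.eq_replicate_card.2 h, Multiset.sum_replicate, smul_eq_mul,
    Multiset.card_replicate]
  lia

theorem card_isChordDiagram (n : ℕ) :
    #{σ : Equiv.Perm (Fin (2 * n)) | IsChordDiagram σ} = Nat.doubleFactorial (2 * n - 1) := by
  have h := Equiv.Perm.card_of_cycleType_mul_eq (α := Fin (2 * n)) (Multiset.replicate n 2)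
  have hcount : ∏ k ∈ (Multiset.replicate n 2).toFinset,
      ((Multiset.replicate n 2).count k).factorial = n.factorial := by
    rcases eq_or_ne n 0 with rfl | hn
    · simp
    · simp [Multiset.toFinset_replicate, hn]
  have hcond : (Multiset.replicate n 2).sum ≤ Fintype.card (Fin (2 * n)) ∧
      ∀ k ∈ Multiset.replicate n 2, 2 ≤ k :=
    ⟨by simp [mul_comm], fun k hk => (Multiset.eq_of_mem_replicate hk).ge⟩
  have hfactorial : (2 * n).factorial = (2 * n - 1).doubleFactorial * (2 ^ n * n.factorial) := by
    rw [← Nat.doubleFactorial_two_mul]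
    cases n with
    | zero => rfl
    | succ m => exact (Nat.factorial_eq_mul_doubleFactorial (2 * m + 1)).trans (mul_comm _ _)
  rw [if_pos hcond, hcount, Fintype.card_fin, hfactorial] at h
  simp only [isChordDiagram_iff_cycleType]
  refine Nat.eq_of_mul_eq_mul_right (by positivity : 0 < 2 ^ n * n.factorial) ?_
  simpa [mul_comm n 2] using h

theorem IsChordDiagram.exists_equiv_sum {n : ℕ} {σ : Equiv.Perm (Fin (2 * n))}
    (h : IsChordDiagram σ) :
    ∃ e : Fin n ⊕ Fin n ≃ Fin (2 * n), σ = e.permCongr (Equiv.sumComm (Fin n) (Fin n)) := by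
  let e : Fin n ⊕ Fin n ≃ Fin (2 * n) := finSumFinEquiv.trans (finCongr (two_mul n).symm)
  have he : IsChordDiagram (e.permCongr (Equiv.sumComm (Fin n) (Fin n))) := by
    refine e.forall_congr_right.1 fun s => ?_
    cases s <;> simp
  obtain ⟨g, hg⟩ := isConj_iff.1 (Equiv.Perm.isConj_of_cycleType_eq
    ((isChordDiagram_iff_cycleType.1 he).trans (isChordDiagram_iff_cycleType.1 h).symm))
  refine ⟨e.trans g, ?_⟩
  rw [← hg]
  ext k
  simp

/-! ### Random positions -/

theorem ae_prod_fst_ne_snd {α : Type*} [MeasurableSpace α] [MeasurableEq α] (μ ν : Measure α)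
    [SFinite ν] [NullSingletonClass ν] : ∀ᵐ z ∂μ.prod ν, z.1 ≠ z.2 :=
  (Measure.ae_prod_iff_ae_ae measurableSet_diagonal.compl).2 <| ae_of_all _ fun x =>
    (Countable.ae_notMem (countable_singleton x) ν).mono fun _ hy h => hy h.symm

theorem ae_pi_injective {ι α : Type*} [Fintype ι] [MeasurableSpace α] [MeasurableEq α]
    (μ : Measure α) [IsProbabilityMeasure μ] [NullSingletonClass μ] :
    ∀ᵐ x ∂Measure.pi fun _ : ι => μ, Function.Injective x := by
  have hne : ∀ i j, i ≠ j → ∀ᵐ x ∂Measure.pi fun _ : ι => μ, x i ≠ x j := by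
    intro i j hij
    have hind : ProbabilityTheory.IndepFun (Function.eval i) (Function.eval j)
        (Measure.pi fun _ : ι => μ) :=
      (ProbabilityTheory.iIndepFun_pi (X := fun _ => id) fun _ => aemeasurable_id).indepFun hij
    have hlaw : MeasurePreserving (fun x : ι → α => (x i, x j)) (Measure.pi fun _ => μ)
        (μ.prod μ) := by
      refine ⟨by fun_prop, ?_⟩
      have hmap := hind.map_prod_eq_prod_map_map
        (measurable_pi_apply i).aemeasurable (measurable_pi_apply j).aemeasurable
      rwa [(measurePreserving_eval (fun _ : ι => μ) i).map_eq,
        (measurePreserving_eval (fun _ : ι => μ) j).map_eq] at hmap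
    exact hlaw.quasiMeasurePreserving.ae (ae_prod_fst_ne_snd μ μ)
  have hall := ae_all_iff.2 fun i => ae_all_iff.2 fun j => ae_all_iff.2 (hne i j)
  exact hall.mono fun x hx i j => not_imp_not.1 (hx i j)

theorem measurableSet_card_filter_eq {ι Ω : Type*} [Fintype ι] [MeasurableSpace Ω]
    {P : Ω → ι → Prop} [∀ x, DecidablePred (P x)] (hP : ∀ k, MeasurableSet {x | P x k}) (p : ℕ) :
    MeasurableSet {x | #{k | P x k} = p} := by
  simp only [Finset.card_filter]
  exact measurableSet_eq_fun (Finset.measurable_sum _ fun k _ =>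
    Measurable.ite (hP k) measurable_const measurable_const) measurable_const

theorem measurableSet_card_exclusionSet_eq {ι α : Type*} [Fintype ι] [LinearOrder α]
    [TopologicalSpace α] [OrderClosedTopology α] [SecondCountableTopology α] [MeasurableSpace α]
    [BorelSpace α] (σ : Equiv.Perm ι) (i : ι) (p : ℕ) :
    MeasurableSet {x : ι → α | #(exclusionSet σ i x) = p} := by
  refine measurableSet_card_filter_eq (fun k => ?_) p
  refine MeasurableSet.union ?_ ?_ <;>
  exact measurableSet_lt (by fun_prop) (by fun_prop)

theorem sum_measure_card_exclusionSet {n : ℕ} {α : Type*} [LinearOrder α] [TopologicalSpace α]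
    [OrderClosedTopology α] [SecondCountableTopology α] [MeasurableSpace α] [BorelSpace α]
    {P : Measure (Fin (2 * n) → α)} [IsProbabilityMeasure P]
    (hP : ∀ᵐ x ∂P, Function.Injective x) (p : ℕ) :
    ∑ c : Equiv.Perm (Fin (2 * n)) × Fin (2 * n) with IsChordDiagram c.1,
      P {x | #(exclusionSet c.1 c.2 x) = 2 * p} = 2 * excludedCount n p := by
  calc ∑ c : Equiv.Perm (Fin (2 * n)) × Fin (2 * n) with IsChordDiagram c.1,
        P {x | #(exclusionSet c.1 c.2 x) = 2 * p}
      = ∫⁻ x, ∑ c : Equiv.Perm (Fin (2 * n)) × Fin (2 * n) with IsChordDiagram c.1,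
          {x | #(exclusionSet c.1 c.2 x) = 2 * p}.indicator 1 x ∂P := by
        have hmeas := fun c : Equiv.Perm (Fin (2 * n)) × Fin (2 * n) =>
          measurableSet_card_exclusionSet_eq (α := α) c.1 c.2 (2 * p)
        rw [lintegral_finsetSum _ fun c _ => measurable_one.indicator (hmeas c)]
        simp only [lintegral_indicator_one (hmeas _)]
    _ = ∫⁻ _, 2 * excludedCount n p ∂P := by
        refine lintegral_congr_ae (hP.mono fun x hx => ?_)
        have h := congrArg (Nat.cast (R := ENNReal)) (card_filter_exclusionSet hx p)
        simpa [indicator_apply, Finset.sum_boole, Finset.filter_filter] using h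
    _ = 2 * excludedCount n p := by simp

theorem ofReal_excludedProb_eq {n : ℕ} (hn : n ≠ 0) {α : Type*} [LinearOrder α]
    [TopologicalSpace α] [OrderClosedTopology α] [SecondCountableTopology α] [MeasurableSpace α]
    [BorelSpace α] {P : Measure (Fin (2 * n) → α)} [IsProbabilityMeasure P]
    (hP : ∀ᵐ x ∂P, Function.Injective x) {p : ℕ} {q : ENNReal}
    (hq : ∀ σ i, IsChordDiagram σ → P {x | #(exclusionSet σ i x) = 2 * p} = q) :
    ENNReal.ofReal (excludedProb n p) = q := by
  have hcard : #{c : Equiv.Perm (Fin (2 * n)) × Fin (2 * n) | IsChordDiagram c.1} =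
      2 * (n * (2 * n - 1).doubleFactorial) := by
    rw [← Finset.univ_product_univ, Finset.filter_product_left]
    simp [card_isChordDiagram]
    lia
  have hsum := sum_measure_card_exclusionSet hP p
  rw [Finset.sum_congr rfl fun c hc => hq c.1 c.2 (Finset.mem_filter.1 hc).2, Finset.sum_const,
    hcard, nsmul_eq_mul, Nat.cast_mul, Nat.cast_ofNat, mul_assoc,
    ENNReal.mul_right_inj two_ne_zero ENNReal.ofNat_ne_top] at hsum
  have hpos : 0 < n * (2 * n - 1).doubleFactorial := by positivity
  rw [excludedProb, ENNReal.ofReal_div_of_pos (by exact_mod_cast hpos), ENNReal.ofReal_natCast,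
    ← hsum, ← Nat.cast_mul, ENNReal.ofReal_natCast, mul_comm,
    ENNReal.mul_div_cancel_right (by exact_mod_cast hpos.ne') (ENNReal.natCast_ne_top _)]

/-- The pairs of points lying entirely below or entirely above the pair `a`. -/
def exclusionRegion {α : Type*} [LinearOrder α] (a : α × α) : Set (α × α) :=
  {b | max b.1 b.2 < min a.1 a.2 ∨ max a.1 a.2 < min b.1 b.2}

section

variable {ι α : Type*} [Fintype ι] [LinearOrder α]

open scoped Classical in
theorem card_exclusionSet_sumComm_inl (j : ι) (x : ι ⊕ ι → α) :
    #(exclusionSet (Equiv.sumComm ι ι) (Sum.inl j) x) =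
      2 * #{k | (x (Sum.inl k), x (Sum.inr k)) ∈
        exclusionRegion (x (Sum.inl j), x (Sum.inr j))} := by
  rw [exclusionSet, Finset.card_filter, Fintype.sum_sum_type, ← Finset.card_filter,
    ← Finset.card_filter, two_mul]
  simp [exclusionRegion, max_comm (x (Sum.inr _)), min_comm (x (Sum.inr _))]

theorem exclusionSet_sumComm_inr (j : ι) (x : ι ⊕ ι → α) :
    exclusionSet (Equiv.sumComm ι ι) (Sum.inr j) x =
      exclusionSet (Equiv.sumComm ι ι) (Sum.inl j) x := by
  simp [exclusionSet, max_comm (x (Sum.inr j)), min_comm (x (Sum.inr j))]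

open scoped Classical in
theorem IsChordDiagram.exists_card_exclusionSet_eq {n : ℕ} {σ : Equiv.Perm (Fin (2 * n))}
    (h : IsChordDiagram σ) (i : Fin (2 * n)) :
    ∃ (e : Fin n ⊕ Fin n ≃ Fin (2 * n)) (j : Fin n), ∀ x : Fin (2 * n) → α,
      #(exclusionSet σ i x) =
        2 * #{k | (x (e (Sum.inl k)), x (e (Sum.inr k))) ∈
          exclusionRegion (x (e (Sum.inl j)), x (e (Sum.inr j)))} := by
  obtain ⟨e, rfl⟩ := h.exists_equiv_sum
  obtain ⟨s, rfl⟩ := e.surjective i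
  rcases s with j | j <;> refine ⟨e, j, fun x => ?_⟩
  · rw [card_exclusionSet_permCongr, card_exclusionSet_sumComm_inl]
    rfl
  · rw [card_exclusionSet_permCongr, exclusionSet_sumComm_inr, card_exclusionSet_sumComm_inl]
    rfl

end

theorem measurePreserving_pairs {ι κ α : Type*} [Fintype ι] [Fintype κ] [MeasurableSpace α]
    (μ : Measure α) [SigmaFinite μ] (e : ι ⊕ ι ≃ κ) :
    MeasurePreserving (fun (x : κ → α) k => (x (e (Sum.inl k)), x (e (Sum.inr k))))
      (Measure.pi fun _ => μ) (Measure.pi fun _ => μ.prod μ) :=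
  ((measurePreserving_arrowProdEquivProdArrow α α ι (fun _ => μ) fun _ => μ).symm.comp
    (measurePreserving_sumPiEquivProdPi fun _ : ι ⊕ ι => μ)).comp
    (measurePreserving_piCongrLeft (fun _ : κ => μ) e).symm

open ProbabilityTheory in
theorem isSetBernoulli_mem {ι Ω : Type*} [Fintype ι] [MeasurableSpace Ω] (μ : Measure Ω)
    [IsProbabilityMeasure μ] {A : Set Ω} (hA : MeasurableSet A) {q : unitInterval}
    (hq : μ.real A = q) :
    IsSetBernoulli (fun y : ι → Ω => {j | y j ∈ A}) univ q (Measure.pi fun _ => μ) := by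
  classical
  have hmeas : Measurable fun y : ι → Ω => {j | y j ∈ A} :=
    measurable_set_iff.2 fun j => (measurable_mem.2 hA).comp (measurable_pi_apply j)
  refine ⟨hmeas.aemeasurable, Measure.ext_of_singleton fun s => ?_⟩
  have hbox : (fun y : ι → Ω => {j | y j ∈ A}) ⁻¹' {s} =
      univ.pi fun j => if j ∈ s then A else Aᶜ := by
    ext y
    simp only [mem_preimage, mem_singleton_iff, Set.ext_iff, mem_ofPred_eq, mem_univ_pi]
    refine forall_congr' fun j => ?_
    by_cases hj : j ∈ s <;> simp [hj]
  have hq' : μ A = unitInterval.toNNReal q := by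
    rw [← ofReal_measureReal, hq]
    exact ENNReal.ofReal_eq_coe_nnreal q.2.1
  have hqc : μ Aᶜ = unitInterval.toNNReal (unitInterval.symm q) := by
    rw [← ofReal_measureReal, probReal_compl_eq_one_sub hA, hq]
    exact ENNReal.ofReal_eq_coe_nnreal (unitInterval.symm q).2.1
  rw [Measure.map_apply hmeas (measurableSet_singleton s), hbox, Measure.pi_pi,
    setBernoulli_singleton _ (subset_univ s) finite_univ, ← hq', ← hqc]
  simp only [apply_ite μ, Finset.prod_ite, Finset.prod_const, ncard_eq_toFinset_card']
  congr 3 <;> ext <;> simp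

open scoped Classical in
theorem measure_pi_card_mem_eq {ι Ω : Type*} [Fintype ι] [MeasurableSpace Ω] (μ : Measure Ω)
    [IsProbabilityMeasure μ] {A : Set Ω} (hA : MeasurableSet A) (p : ℕ) :
    Measure.pi (fun _ : ι => μ) {y | #{j | y j ∈ A} = p} =
      ENNReal.ofReal ((bernsteinPolynomial ℝ (Fintype.card ι) p).eval (μ.real A)) := by
  let q : unitInterval := ⟨μ.real A, measureReal_nonneg, measureReal_le_one⟩
  have hlaw := isSetBernoulli_mem (ι := ι) μ hA (q := q) rfl
  have h := ProbabilityTheory.map_ncard_setBernoulli_singleton (finite_univ (α := ι)) q p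
  rw [← hlaw.map_eq, AEMeasurable.map_map_of_aemeasurable measurable_ncard.aemeasurable
      hlaw.aemeasurable, Measure.map_apply_of_aemeasurable
      (measurable_ncard.comp_aemeasurable hlaw.aemeasurable) (measurableSet_singleton p)] at h
  simpa [bernsteinPolynomial, ncard_univ, ncard_eq_toFinset_card', preimage,
    Function.comp_def] using h

theorem notMem_exclusionRegion_self {α : Type*} [LinearOrder α] (a : α × α) :
    a ∉ exclusionRegion a := by
  rintro (h | h) <;> exact (min_le_max.trans_lt h).false

theorem measurableSet_mem_exclusionRegion {α : Type*} [LinearOrder α] [TopologicalSpace α]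
    [OrderClosedTopology α] [SecondCountableTopology α] [MeasurableSpace α] [BorelSpace α] :
    MeasurableSet {z : (α × α) × (α × α) | z.2 ∈ exclusionRegion z.1} :=
  .union (measurableSet_lt (by fun_prop) (by fun_prop))
    (measurableSet_lt (by fun_prop) (by fun_prop))

open scoped Classical in
theorem measure_pi_card_mem_apply_eq {m : ℕ} {Ω : Type*} [MeasurableSpace Ω] (μ : Measure Ω)
    [IsProbabilityMeasure μ] {B : Ω → Set Ω} (hB : MeasurableSet {z : Ω × Ω | z.2 ∈ B z.1})
    (hself : ∀ a, a ∉ B a) (j : Fin (m + 1)) (p : ℕ) :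
    Measure.pi (fun _ : Fin (m + 1) => μ) {y | #{k | y k ∈ B (y j)} = p} =
      ∫⁻ a, ENNReal.ofReal ((bernsteinPolynomial ℝ m p).eval (μ.real (B a))) ∂μ := by
  have hmeas : MeasurableSet {z : Ω × (Fin m → Ω) | #{k | z.2 k ∈ B z.1} = p} :=
    measurableSet_card_filter_eq (fun k =>
      (show Measurable fun z : Ω × (Fin m → Ω) => (z.1, z.2 k) by fun_prop) hB) p
  have hsplit : {y : Fin (m + 1) → Ω | #{k | y k ∈ B (y j)} = p} =
      MeasurableEquiv.piFinSuccAbove (fun _ => Ω) j ⁻¹' {z | #{k | z.2 k ∈ B z.1} = p} := by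
    ext y
    simp [Finset.card_filter, Fin.sum_univ_succAbove _ j, hself, Fin.removeNth, -Finset.sum_boole]
  rw [hsplit, (measurePreserving_piFinSuccAbove (fun _ => μ) j).measure_preimage_equiv,
    Measure.prod_apply hmeas]
  refine lintegral_congr fun a => ?_
  have hBa : MeasurableSet (B a) := measurable_prodMk_left hB
  simpa using measure_pi_card_mem_eq (ι := Fin m) μ hBa p

theorem ofReal_excludedProb_succ (m p : ℕ) {α : Type*} [LinearOrder α] [TopologicalSpace α]
    [OrderClosedTopology α] [SecondCountableTopology α] [MeasurableSpace α] [BorelSpace α]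
    (μ : Measure α) [IsProbabilityMeasure μ] [NullSingletonClass μ] :
    ENNReal.ofReal (excludedProb (m + 1) p) =
      ∫⁻ a, ENNReal.ofReal
        ((bernsteinPolynomial ℝ m p).eval ((μ.prod μ).real (exclusionRegion a))) ∂μ.prod μ := by
  classical
  refine ofReal_excludedProb_eq m.succ_ne_zero (ae_pi_injective μ) fun σ i h => ?_
  obtain ⟨e, j, hcard⟩ := h.exists_card_exclusionSet_eq (α := α) i
  rw [← measure_pi_card_mem_apply_eq (μ.prod μ) measurableSet_mem_exclusionRegion
    notMem_exclusionRegion_self j, ← (measurePreserving_pairs μ e).measure_preimage]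
  · simp [hcard]
  · refine (measurableSet_card_filter_eq (fun k => ?_) p).nullMeasurableSet
    exact (show Measurable fun y : Fin (m + 1) → α × α => (y j, y k) by fun_prop)
      measurableSet_mem_exclusionRegion

/-! ### The mixing density -/

theorem excludedDensity_eq (t : ℝ) :
    excludedDensity t = Real.pi / 2 - 2 * Real.arctan √(2 * t - 1) := by
  rw [excludedDensity]
  split_ifs with h
  · simp [Real.sqrt_eq_zero_of_nonpos (by linarith : 2 * t - 1 ≤ 0)]
  · rfl

theorem continuous_excludedDensity : Continuous excludedDensity := by
  simp only [funext excludedDensity_eq]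
  fun_prop

theorem abs_excludedDensity_le (t : ℝ) : |excludedDensity t| ≤ Real.pi / 2 := by
  have := Real.arctan_nonneg.2 (Real.sqrt_nonneg (2 * t - 1))
  have := Real.arctan_lt_pi_div_two √(2 * t - 1)
  rw [excludedDensity_eq, abs_le]
  constructor <;> linarith

theorem antitone_excludedDensity : Antitone excludedDensity := by
  intro s t hst
  have h := Real.arctan_mono (Real.sqrt_le_sqrt (by linarith : 2 * s - 1 ≤ 2 * t - 1))
  linarith [excludedDensity_eq s, excludedDensity_eq t]

theorem excludedDensity_one : excludedDensity 1 = 0 := by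
  norm_num [excludedDensity_eq]
  ring

theorem excludedDensity_nonneg {t : ℝ} (ht : t ≤ 1) : 0 ≤ excludedDensity t :=
  excludedDensity_one.symm.le.trans (antitone_excludedDensity ht)

theorem excludedDensity_nonpos {t : ℝ} (ht : 1 ≤ t) : excludedDensity t ≤ 0 :=
  (antitone_excludedDensity ht).trans excludedDensity_one.le

theorem excludedDensity_eq_arccos {t : ℝ} (ht : 0 < t) :
    excludedDensity t = Real.pi / 2 - 2 * Real.arccos (1 / √(2 * t)) := by
  have hsq : √(2 * t) ^ 2 = 2 * t := Real.sq_sqrt (by positivity)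
  have hratio : (1 - (1 / √(2 * t)) ^ 2) / (1 / √(2 * t)) ^ 2 = 2 * t - 1 := by
    field_simp
    rw [hsq]
  have hsqrt : √(1 - (1 / √(2 * t)) ^ 2) / (1 / √(2 * t)) = √(2 * t - 1) := by
    rw [← hratio, Real.sqrt_div' _ (by positivity), Real.sqrt_sq (by positivity)]
  rw [excludedDensity_eq, Real.arccos_eq_arctan (by positivity), hsqrt]

theorem cos_add_sin_eq_sqrt_two_mul_cos (θ : ℝ) :
    Real.cos θ + Real.sin θ = √2 * Real.cos (θ - Real.pi / 4) := by
  rw [Real.cos_sub, Real.cos_pi_div_four, Real.sin_pi_div_four]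
  linear_combination -(Real.cos θ + Real.sin θ) / 2 * Real.sq_sqrt zero_le_two

theorem cos_nonneg_and_sin_nonneg_iff {θ : ℝ} (hθ : θ ∈ Ioo (-Real.pi) Real.pi) :
    0 ≤ Real.cos θ ∧ 0 ≤ Real.sin θ ↔ |θ - Real.pi / 4| ≤ Real.pi / 4 := by
  have hquadrant : |θ - Real.pi / 4| ≤ Real.pi / 4 ↔ 0 ≤ θ ∧ θ ≤ Real.pi / 2 := by
    rw [abs_le]
    constructor <;> rintro ⟨_, _⟩ <;> constructor <;> linarith
  rw [hquadrant]
  constructor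
  · rintro ⟨hcos, hsin⟩
    refine ⟨not_lt.1 fun h => ?_, not_lt.1 fun h => ?_⟩
    · exact (Real.sin_neg_of_neg_of_neg_pi_lt h hθ.1).not_ge hsin
    · exact (Real.cos_neg_of_pi_div_two_lt_of_lt h (by linarith [hθ.2])).not_ge hcos
  · rintro ⟨h0, h1⟩
    exact ⟨Real.cos_nonneg_of_mem_Icc ⟨by linarith, h1⟩,
      Real.sin_nonneg_of_nonneg_of_le_pi h0 hθ.2.le⟩

theorem arccos_le_iff_cos_le {y φ : ℝ} (hy : -1 ≤ y) (hφ : φ ∈ Icc 0 Real.pi) :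
    Real.arccos y ≤ φ ↔ Real.cos φ ≤ y := by
  constructor
  · intro h
    rcases le_total y 1 with hy1 | hy1
    · rw [← Real.cos_arccos hy hy1]
      exact Real.cos_le_cos_of_nonneg_of_le_pi (Real.arccos_nonneg y) hφ.2 h
    · exact (Real.cos_le_one φ).trans hy1
  · intro h
    simpa only [Real.arccos_cos hφ.1 hφ.2] using Real.arccos_le_arccos h

theorem volume_le_abs_le {c d : ℝ} (hc : 0 ≤ c) :
    volume {φ : ℝ | |φ| ≤ d ∧ c ≤ |φ|} = ENNReal.ofReal (2 * (d - c)) := by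
  have hset : {φ : ℝ | |φ| ≤ d ∧ c ≤ |φ|} = Icc c d ∪ Icc (-d) (-c) := by
    ext φ
    simp only [mem_ofPred_eq, mem_union, mem_Icc, abs_le, le_abs]
    constructor
    · rintro ⟨⟨_, _⟩, _ | _⟩ <;> [left; right] <;> constructor <;> linarith
    · rintro (⟨_, _⟩ | ⟨_, _⟩) <;> [refine ⟨⟨?_, ?_⟩, .inl ?_⟩; refine ⟨⟨?_, ?_⟩, .inr ?_⟩] <;>
      linarith
  have hdisj : AEDisjoint volume (Icc c d) (Icc (-d) (-c)) :=
    measure_mono_null (t := {0}) (fun φ hφ => le_antisymm (by linarith [hφ.2.2])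
      (by linarith [hφ.1.1])) Real.volume_singleton
  rw [hset, measure_union₀ measurableSet_Icc.nullMeasurableSet hdisj, Real.volume_Icc,
    Real.volume_Icc, neg_sub_neg, ENNReal.ofReal_mul zero_le_two, ENNReal.ofReal_ofNat, two_mul]

theorem volume_angles_simplex {t : ℝ} (ht : 0 < t) :
    volume {θ ∈ Ioo (-Real.pi) Real.pi | 0 ≤ √t * Real.cos θ ∧ 0 ≤ √t * Real.sin θ ∧
      √t * Real.cos θ + √t * Real.sin θ ≤ 1} = ENNReal.ofReal (excludedDensity t) := by
  have hr : 0 < √t := Real.sqrt_pos.2 ht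
  have hset : {θ ∈ Ioo (-Real.pi) Real.pi | 0 ≤ √t * Real.cos θ ∧ 0 ≤ √t * Real.sin θ ∧
      √t * Real.cos θ + √t * Real.sin θ ≤ 1} =
      (fun θ => θ - Real.pi / 4) ⁻¹'
        {φ | |φ| ≤ Real.pi / 4 ∧ Real.arccos (1 / √(2 * t)) ≤ |φ|} := by
    ext θ
    have hsum : √t * Real.cos θ + √t * Real.sin θ ≤ 1 ↔
        Real.cos |θ - Real.pi / 4| ≤ 1 / √(2 * t) := by
      rw [← mul_add, cos_add_sin_eq_sqrt_two_mul_cos, ← mul_assoc, mul_comm √t,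
        ← Real.sqrt_mul zero_le_two, Real.cos_abs, le_div_iff₀' (by positivity)]
    have harccos : |θ - Real.pi / 4| ≤ Real.pi / 4 →
        (Real.arccos (1 / √(2 * t)) ≤ |θ - Real.pi / 4| ↔
          Real.cos |θ - Real.pi / 4| ≤ 1 / √(2 * t)) := fun habs =>
      arccos_le_iff_cos_le (by linarith [show 0 ≤ 1 / √(2 * t) by positivity])
        ⟨abs_nonneg _, by linarith [Real.pi_pos]⟩
    simp only [mem_ofPred_eq, mem_preimage, mul_nonneg_iff_of_pos_left hr, ← and_assoc, hsum]
    rw [and_assoc (a := θ ∈ Ioo (-Real.pi) Real.pi)]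
    constructor
    · rintro ⟨⟨hθ, hquad⟩, hcos⟩
      have habs := (cos_nonneg_and_sin_nonneg_iff hθ).1 hquad
      exact ⟨habs, (harccos habs).2 hcos⟩
    · rintro ⟨habs, hcos⟩
      have hθ : θ ∈ Ioo (-Real.pi) Real.pi := by
        have := abs_le.1 habs
        constructor <;> linarith [Real.pi_pos]
      exact ⟨⟨hθ, (cos_nonneg_and_sin_nonneg_iff hθ).2 habs⟩, (harccos habs).1 hcos⟩
  have hshift := fun A : Set ℝ => measure_preimage_add_right volume (-(Real.pi / 4)) A
  simp only [← sub_eq_add_neg] at hshift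
  rw [hset, hshift, volume_le_abs_le (Real.arccos_nonneg _),
    excludedDensity_eq_arccos ht]
  ring_nf

theorem lintegral_Ioi_comp_sq (F : ℝ → ENNReal) :
    ∫⁻ r in Ioi (0 : ℝ), ENNReal.ofReal (2 * r) * F (r ^ 2) = ∫⁻ t in Ioi (0 : ℝ), F t := by
  have himage : (fun r : ℝ => r ^ 2) '' Ioi 0 = Ioi 0 :=
    Subset.antisymm (image_subset_iff.2 fun r hr => pow_pos (mem_Ioi.1 hr) 2)
      fun t ht =>
      ⟨√t, Real.sqrt_pos.2 ht, Real.sq_sqrt (le_of_lt ht)⟩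
  have h := lintegral_image_eq_lintegral_abs_deriv_mul (f := fun r : ℝ => r ^ 2)
    (f' := fun r => 2 * r) measurableSet_Ioi
    (fun r _ => by simpa using (hasDerivAt_pow 2 r).hasDerivWithinAt)
    (fun r hr s hs h => (pow_left_inj₀ (le_of_lt hr) (le_of_lt hs) two_ne_zero).1 h) F
  rw [himage] at h
  rw [h]
  refine setLIntegral_congr_fun measurableSet_Ioi fun r hr => ?_
  rw [abs_of_pos (mul_pos two_pos hr)]

theorem two_mul_setLIntegral_norm_sq {S : Set (ℝ × ℝ)} (hS : MeasurableSet S) {F : ℝ → ENNReal}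
    (hF : Measurable F) :
    2 * ∫⁻ z in S, F (z.1 ^ 2 + z.2 ^ 2) = ∫⁻ t in Ioi (0 : ℝ),
      volume {θ ∈ Ioo (-Real.pi) Real.pi | (√t * Real.cos θ, √t * Real.sin θ) ∈ S} * F t := by
  classical
  have hG : Measurable (S.indicator fun z : ℝ × ℝ => F (z.1 ^ 2 + z.2 ^ 2)) :=
    Measurable.indicator (by fun_prop) hS
  rw [← lintegral_Ioi_comp_sq, ← lintegral_indicator hS, ← lintegral_comp_polarCoord_symm,
    polarCoord_target, Measure.volume_eq_prod, ← Measure.prod_restrict, lintegral_prod,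
    ← lintegral_const_mul' _ _ ENNReal.ofNat_ne_top]
  · refine setLIntegral_congr_fun measurableSet_Ioi fun r hr => ?_
    have hSr : MeasurableSet {θ : ℝ | (r * Real.cos θ, r * Real.sin θ) ∈ S} :=
      (show Measurable fun θ : ℝ => (r * Real.cos θ, r * Real.sin θ) by fun_prop) hS
    have hfiber : ∀ θ : ℝ, ENNReal.ofReal r • S.indicator
        (fun z : ℝ × ℝ => F (z.1 ^ 2 + z.2 ^ 2)) (polarCoord.symm (r, θ)) =
        {θ : ℝ | (r * Real.cos θ, r * Real.sin θ) ∈ S}.indicator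
          (fun _ => ENNReal.ofReal r * F (r ^ 2)) θ := by
      intro θ
      have hnorm : (r * Real.cos θ) ^ 2 + (r * Real.sin θ) ^ 2 = r ^ 2 := by
        linear_combination r ^ 2 * Real.cos_sq_add_sin_sq θ
      simp only [indicator_apply, polarCoord_symm_apply, mem_ofPred_eq, hnorm, smul_eq_mul,
        mul_ite, mul_zero]
    simp only [hfiber]
    rw [lintegral_indicator hSr, setLIntegral_const, Measure.restrict_apply hSr, inter_comm,
      Real.sqrt_sq (le_of_lt hr), ENNReal.ofReal_mul zero_le_two, ENNReal.ofReal_ofNat]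
    simp only [Set.inter_def, mem_ofPred_eq]
    ring
  · exact ((by fun_prop : Measurable fun z : ℝ × ℝ => ENNReal.ofReal z.1).smul
      (hG.comp continuous_polarCoord_symm.measurable)).aemeasurable

theorem lintegral_prod_min_max {α : Type*} [LinearOrder α] [TopologicalSpace α]
    [OrderClosedTopology α] [SecondCountableTopology α] [MeasurableSpace α] [BorelSpace α]
    (μ : Measure α) [SFinite μ] [NullSingletonClass μ] {f : α × α → ENNReal} (hf : Measurable f) :
    ∫⁻ z, f (min z.1 z.2, max z.1 z.2) ∂μ.prod μ =
      2 * ∫⁻ z in {z | z.1 ≤ z.2}, f z ∂μ.prod μ := by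
  have hle : MeasurableSet {z : α × α | z.1 ≤ z.2} := measurableSet_le (by fun_prop) (by fun_prop)
  have hcompl : ({z : α × α | z.1 ≤ z.2}ᶜ : Set (α × α)) =ᵐ[μ.prod μ]
      (Prod.swap ⁻¹' {z : α × α | z.1 ≤ z.2} : Set (α × α)) := by
    filter_upwards [ae_prod_fst_ne_snd μ μ] with z hz
    exact propext (not_le.trans ⟨le_of_lt, fun h => lt_of_le_of_ne h hz.symm⟩)
  rw [← lintegral_add_compl _ hle, setLIntegral_congr hcompl, two_mul]
  congr 1
  · exact setLIntegral_congr_fun hle fun z hz => by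
      simp only [min_eq_left (show z.1 ≤ z.2 from hz), max_eq_right (show z.1 ≤ z.2 from hz)]
  · rw [← (Measure.measurePreserving_swap (μ := μ) (ν := μ)).setLIntegral_comp_preimage hle hf]
    exact setLIntegral_congr_fun (measurable_swap hle) fun z hz => by
      simp only [min_eq_right (show z.2 ≤ z.1 from hz), max_eq_left (show z.2 ≤ z.1 from hz)]
      rfl

theorem lintegral_min_sq_add_one_sub_max_sq {F : ℝ → ENNReal} (hF : Measurable F) :
    ∫⁻ z, F (min z.1 z.2 ^ 2 + (1 - max z.1 z.2) ^ 2)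
        ∂(volume.restrict (Icc (0 : ℝ) 1)).prod (volume.restrict (Icc (0 : ℝ) 1)) =
      ∫⁻ t in Ioi (0 : ℝ), ENNReal.ofReal (excludedDensity t) * F t := by
  have hreflect : MeasurePreserving (Prod.map id fun y : ℝ => 1 - y) (volume : Measure (ℝ × ℝ))
      volume :=
    (MeasurePreserving.id _).prod (Measure.measurePreserving_sub_left volume 1)
  have hsimplex : MeasurableSet {z : ℝ × ℝ | 0 ≤ z.1 ∧ 0 ≤ z.2 ∧ z.1 + z.2 ≤ 1} := by
    measurability
  have hpreimage : {z : ℝ × ℝ | z.1 ≤ z.2} ∩ Icc 0 1 ×ˢ Icc 0 1 =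
      Prod.map id (fun y : ℝ => 1 - y) ⁻¹' {z | 0 ≤ z.1 ∧ 0 ≤ z.2 ∧ z.1 + z.2 ≤ 1} := by
    ext z
    simp only [mem_inter_iff, mem_prod, mem_Icc, mem_preimage, mem_ofPred_eq, Prod.map_fst,
      Prod.map_snd, id]
    constructor
    · rintro ⟨_, ⟨_, _⟩, _, _⟩
      refine ⟨?_, ?_, ?_⟩ <;> linarith
    · rintro ⟨_, _, _⟩
      refine ⟨?_, ⟨?_, ?_⟩, ?_, ?_⟩ <;> linarith
  rw [lintegral_prod_min_max _ (f := fun z => F (z.1 ^ 2 + (1 - z.2) ^ 2)) (by fun_prop),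
    Measure.prod_restrict, Measure.restrict_restrict (measurableSet_le (by fun_prop) (by fun_prop)),
    hpreimage, ← Measure.volume_eq_prod]
  have hcomp := hreflect.setLIntegral_comp_preimage hsimplex
    (f := fun z => F (z.1 ^ 2 + z.2 ^ 2)) (by fun_prop)
  simp only [Prod.map_fst, Prod.map_snd, id] at hcomp
  rw [hcomp, two_mul_setLIntegral_norm_sq hsimplex hF]
  exact setLIntegral_congr_fun measurableSet_Ioi fun t ht => by
    simp only [mem_ofPred_eq, volume_angles_simplex ht]

theorem real_prod_exclusionRegion {α : Type*} [LinearOrder α] [TopologicalSpace α]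
    [OrderClosedTopology α] [MeasurableSpace α] [OpensMeasurableSpace α] (μ : Measure α)
    [IsFiniteMeasure μ] (a : α × α) :
    (μ.prod μ).real (exclusionRegion a) =
      μ.real (Iio (min a.1 a.2)) ^ 2 + μ.real (Ioi (max a.1 a.2)) ^ 2 := by
  have hset : exclusionRegion a = Iio (min a.1 a.2) ×ˢ Iio (min a.1 a.2) ∪
      Ioi (max a.1 a.2) ×ˢ Ioi (max a.1 a.2) := by
    ext b
    simp only [exclusionRegion, max_lt_iff, lt_min_iff, mem_union, mem_prod, mem_ofPred_eq,
      mem_Iio, mem_Ioi]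
    tauto
  have hdisj : Disjoint (Iio (min a.1 a.2) ×ˢ Iio (min a.1 a.2))
      (Ioi (max a.1 a.2) ×ˢ Ioi (max a.1 a.2)) :=
    Disjoint.set_prod_left (disjoint_left.2 fun _ h h' =>
      (min_le_max.trans_lt (h'.trans h)).false) _ _
  rw [hset, measureReal_union hdisj (measurableSet_Ioi.prod measurableSet_Ioi),
    measureReal_prod_prod, measureReal_prod_prod, sq, sq]

theorem ofReal_excludedProb_succ_eq_lintegral (m p : ℕ) :
    ENNReal.ofReal (excludedProb (m + 1) p) = ∫⁻ t in Ioi (0 : ℝ),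
      ENNReal.ofReal (excludedDensity t) *
        ENNReal.ofReal ((bernsteinPolynomial ℝ m p).eval t) := by
  have : IsProbabilityMeasure (volume.restrict (Icc (0 : ℝ) 1)) := ⟨by simp⟩
  rw [← lintegral_min_sq_add_one_sub_max_sq (by fun_prop),
    ofReal_excludedProb_succ m p (volume.restrict (Icc (0 : ℝ) 1)), Measure.prod_restrict]
  refine setLIntegral_congr_fun (measurableSet_Icc.prod measurableSet_Icc) fun a ha => ?_
  obtain ⟨⟨h10, h11⟩, h20, h21⟩ := ha
  have hmin : Iio (min a.1 a.2) ∩ Icc 0 1 = Ico 0 (min a.1 a.2) := by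
    ext t
    simp only [mem_inter_iff, mem_Iio, mem_Icc, mem_Ico]
    exact ⟨fun h => ⟨h.2.1, h.1⟩, fun h => ⟨h.2, h.1, h.2.le.trans ((min_le_left _ _).trans h11)⟩⟩
  have hmax : Ioi (max a.1 a.2) ∩ Icc 0 1 = Ioc (max a.1 a.2) 1 := by
    ext t
    simp only [mem_inter_iff, mem_Ioi, mem_Icc, mem_Ioc]
    exact ⟨fun h => ⟨h.1, h.2.2⟩, fun h => ⟨h.1, (h10.trans (le_max_left _ _)).trans h.1.le, h.2⟩⟩
  rw [← Measure.prod_restrict, real_prod_exclusionRegion,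
    measureReal_restrict_apply measurableSet_Iio, measureReal_restrict_apply measurableSet_Ioi,
    hmin, hmax, Real.volume_real_Ico_of_le (le_min h10 h20),
    Real.volume_real_Ioc_of_le (max_le h11 h21), sub_zero]

theorem eval_bernsteinPolynomial_nonneg (m p : ℕ) {t : ℝ} (ht : t ∈ Icc (0 : ℝ) 1) :
    0 ≤ (bernsteinPolynomial ℝ m p).eval t := by
  have := sub_nonneg.2 ht.2
  have := ht.1
  simp only [bernsteinPolynomial, Polynomial.eval_mul, Polynomial.eval_pow, Polynomial.eval_sub,
    Polynomial.eval_one, Polynomial.eval_X, Polynomial.eval_natCast]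
  positivity

theorem excludedProb_nonneg (n p : ℕ) : 0 ≤ excludedProb n p := by
  rw [excludedProb]
  positivity

theorem excludedProb_succ_eq_integral (m p : ℕ) :
    excludedProb (m + 1) p =
      ∫ t in (0 : ℝ)..1, (bernsteinPolynomial ℝ m p).eval t * excludedDensity t := by
  have hnonneg : ∀ t ∈ Ioc (0 : ℝ) 1,
      0 ≤ (bernsteinPolynomial ℝ m p).eval t * excludedDensity t := fun t ht =>
    mul_nonneg (eval_bernsteinPolynomial_nonneg m p (Ioc_subset_Icc_self ht))
      (excludedDensity_nonneg ht.2)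
  have hbeyond : ∫⁻ t in Ioi (1 : ℝ), ENNReal.ofReal (excludedDensity t) *
      ENNReal.ofReal ((bernsteinPolynomial ℝ m p).eval t) = 0 :=
    setLIntegral_eq_zero measurableSet_Ioi fun t ht => by
      simp only [ENNReal.ofReal_of_nonpos (excludedDensity_nonpos (le_of_lt ht)), zero_mul,
        Pi.zero_apply]
  rw [intervalIntegral.integral_of_le zero_le_one,
    ← ENNReal.ofReal_eq_ofReal_iff (excludedProb_nonneg _ _)
      (setIntegral_nonneg measurableSet_Ioc hnonneg),
    ofReal_excludedProb_succ_eq_lintegral, ← Ioc_union_Ioi_eq_Ioi zero_le_one,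
    lintegral_union measurableSet_Ioi (Ioc_disjoint_Ioi le_rfl), hbeyond, add_zero,
    ofReal_integral_eq_lintegral_ofReal
      (Continuous.integrableOn_Ioc (by have := continuous_excludedDensity; fun_prop))
      (ae_restrict_of_forall_mem measurableSet_Ioc hnonneg)]
  refine setLIntegral_congr_fun measurableSet_Ioc fun t ht => ?_
  rw [mul_comm, ENNReal.ofReal_mul
    (eval_bernsteinPolynomial_nonneg m p (Ioc_subset_Icc_self ht))]

/-! ### Concentration of beta densities -/

theorem exists_forall_abs_sub_le_add_mul_dist_sq {α : Type*} [PseudoMetricSpace α] {f : α → ℝ}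
    {x : α} {M ε : ℝ} (hf : ∀ t, |f t| ≤ M) (hx : ContinuousAt f x) (hε : 0 < ε) :
    ∃ C, ∀ t, |f t - f x| ≤ ε + C * dist t x ^ 2 := by
  obtain ⟨δ, hδ, hfδ⟩ := Metric.continuousAt_iff.1 hx ε hε
  have hM : 0 ≤ M := (abs_nonneg _).trans (hf x)
  refine ⟨2 * M / δ ^ 2, fun t => ?_⟩
  rcases lt_or_ge (dist t x) δ with hnear | hfar
  · have := (hfδ hnear).le
    rw [Real.dist_eq] at this
    exact this.trans (le_add_of_nonneg_right (by positivity))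
  · calc |f t - f x| ≤ |f t| + |f x| := abs_sub _ _
      _ ≤ 2 * M / δ ^ 2 * δ ^ 2 := by
        rw [div_mul_cancel₀ _ (by positivity)]
        linarith [hf t, hf x]
      _ ≤ 2 * M / δ ^ 2 * dist t x ^ 2 := by gcongr
      _ ≤ ε + 2 * M / δ ^ 2 * dist t x ^ 2 := le_add_of_nonneg_left hε.le

section Concentration

variable {ι α : Type*} [PseudoMetricSpace α] [MeasurableSpace α] {μ : Measure α}
  {l : Filter ι} {φ : ι → α → ℝ} {f : α → ℝ} {x : α} {M : ℝ}

theorem tendsto_integral_mul_sub (hφ : ∀ i, 0 ≤ᵐ[μ] φ i) (hint : ∀ i, Integrable (φ i) μ)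
    (hmass : Tendsto (fun i => ∫ t, φ i t ∂μ) l (𝓝 1))
    (hint_sq : ∀ i, Integrable (fun t => φ i t * dist t x ^ 2) μ)
    (hsq : Tendsto (fun i => ∫ t, φ i t * dist t x ^ 2 ∂μ) l (𝓝 0))
    (hf : ∀ t, |f t| ≤ M) (hx : ContinuousAt f x) :
    Tendsto (fun i => ∫ t, φ i t * (f t - f x) ∂μ) l (𝓝 0) := by
  rw [Metric.tendsto_nhds]
  intro ε hε
  obtain ⟨C, hC⟩ := exists_forall_abs_sub_le_add_mul_dist_sq hf hx (half_pos hε)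
  have hle : ∀ i, |∫ t, φ i t * (f t - f x) ∂μ| ≤
      ε / 2 * ∫ t, φ i t ∂μ + C * ∫ t, φ i t * dist t x ^ 2 ∂μ := by
    intro i
    rw [← integral_const_mul, ← integral_const_mul,
      ← integral_add ((hint i).const_mul _) ((hint_sq i).const_mul _), ← Real.norm_eq_abs]
    refine norm_integral_le_of_norm_le (((hint i).const_mul _).add ((hint_sq i).const_mul _)) ?_
    filter_upwards [hφ i] with t ht
    rw [Real.norm_eq_abs, abs_mul, abs_of_nonneg ht]
    linarith [mul_le_mul_of_nonneg_left (hC t) ht]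
  have hlim : Tendsto (fun i => ε / 2 * ∫ t, φ i t ∂μ + C * ∫ t, φ i t * dist t x ^ 2 ∂μ) l
      (𝓝 (ε / 2 * 1 + C * 0)) :=
    (hmass.const_mul _).add (hsq.const_mul _)
  filter_upwards [hlim.eventually_lt_const (by linarith : ε / 2 * 1 + C * 0 < ε)] with i hi
  rw [dist_zero_right, Real.norm_eq_abs]
  exact (hle i).trans_lt hi

theorem tendsto_integral_mul_of_tendsto_integral_mul_dist_sq (hφ : ∀ i, 0 ≤ᵐ[μ] φ i)
    (hint : ∀ i, Integrable (φ i) μ) (hmass : Tendsto (fun i => ∫ t, φ i t ∂μ) l (𝓝 1))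
    (hint_sq : ∀ i, Integrable (fun t => φ i t * dist t x ^ 2) μ)
    (hsq : Tendsto (fun i => ∫ t, φ i t * dist t x ^ 2 ∂μ) l (𝓝 0))
    (hf : ∀ t, |f t| ≤ M) (hfm : AEStronglyMeasurable f μ) (hx : ContinuousAt f x) :
    Tendsto (fun i => ∫ t, φ i t * f t ∂μ) l (𝓝 (f x)) := by
  have hsplit : ∀ i, ∫ t, φ i t * f t ∂μ =
      ∫ t, φ i t * (f t - f x) ∂μ + (∫ t, φ i t ∂μ) * f x := by
    intro i
    simp only [mul_sub]
    rw [integral_sub ((hint i).mul_bdd hfm (ae_of_all _ hf)) ((hint i).mul_const _),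
      integral_mul_const, sub_add_cancel]
  simp only [hsplit]
  simpa only [zero_add, one_mul] using
    (tendsto_integral_mul_sub hφ hint hmass hint_sq hsq hf hx).add (hmass.mul_const (f x))

end Concentration

theorem integral_eval_derivative (P : Polynomial ℝ) (a b : ℝ) :
    ∫ t in a..b, P.derivative.eval t = P.eval b - P.eval a :=
  intervalIntegral.integral_eq_sub_of_hasDerivAt (fun t _ => P.hasDerivAt t)
    (P.derivative.continuous.intervalIntegrable _ _)

theorem integral_bernsteinPolynomial {m p : ℕ} (hp : p ≤ m) :
    ∫ t in (0 : ℝ)..1, (bernsteinPolynomial ℝ m p).eval t = 1 / (m + 1) := by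
  have hstep : ∀ q, ((m : ℝ) + 1) * ((∫ t in (0 : ℝ)..1, (bernsteinPolynomial ℝ m q).eval t) -
      ∫ t in (0 : ℝ)..1, (bernsteinPolynomial ℝ m (q + 1)).eval t) =
      if q = m then 1 else 0 := by
    intro q
    have h := integral_eval_derivative (bernsteinPolynomial ℝ (m + 1) (q + 1)) 0 1
    have hcont : ∀ k, IntervalIntegrable (fun t => (bernsteinPolynomial ℝ m k).eval t) volume 0 1 :=
      fun k => (Polynomial.continuous _).intervalIntegrable _ _
    simpa only [bernsteinPolynomial.derivative_succ, Nat.add_sub_cancel, Polynomial.eval_mul,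
      Nat.cast_add_one, Polynomial.eval_add, Polynomial.eval_one, Polynomial.eval_natCast,
      Polynomial.eval_sub, intervalIntegral.integral_const_mul,
      intervalIntegral.integral_sub (hcont _) (hcont _), bernsteinPolynomial.eval_at_0,
      bernsteinPolynomial.eval_at_1, Nat.add_right_cancel_iff, if_false,
      Nat.add_eq_zero_iff, one_ne_zero, and_false, sub_zero] using h
  induction hp using Nat.decreasingInduction with
  | self =>
    have h := hstep m
    rw [if_pos rfl, bernsteinPolynomial.eq_zero_of_lt ℝ m.lt_succ_self] at h
    rw [eq_div_iff (by positivity), mul_comm]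
    simpa using h
  | of_succ q hq ih =>
    have h := hstep q
    rw [if_neg hq.ne, ih, mul_eq_zero_iff_left (by positivity), sub_eq_zero] at h
    exact h

theorem mul_eval_bernsteinPolynomial (m p : ℕ) (t : ℝ) :
    t * (bernsteinPolynomial ℝ m p).eval t =
      (p + 1) / (m + 1) * (bernsteinPolynomial ℝ (m + 1) (p + 1)).eval t := by
  have h : ((m : ℝ) + 1) * m.choose p = (m + 1).choose (p + 1) * (p + 1) := by
    exact_mod_cast Nat.add_one_mul_choose_eq m p
  simp only [bernsteinPolynomial, Polynomial.eval_mul, Polynomial.eval_pow, Polynomial.eval_sub,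
    Polynomial.eval_one, Polynomial.eval_X, Polynomial.eval_natCast, Nat.add_sub_add_right]
  field_simp
  linear_combination (t ^ (p + 1) * (1 - t) ^ (m - p)) * h

theorem integral_bernsteinPolynomial_mul_sq {m p : ℕ} (hp : p ≤ m) (x : ℝ) :
    (m + 1) * ∫ t in (0 : ℝ)..1, (bernsteinPolynomial ℝ m p).eval t * (t - x) ^ 2 =
      (p + 1) / (m + 2) * ((p + 2) / (m + 3)) - 2 * x * ((p + 1) / (m + 2)) + x ^ 2 := by
  have hexpand : ∀ t : ℝ, (bernsteinPolynomial ℝ m p).eval t * (t - x) ^ 2 =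
      (p + 1) / (m + 1) * ((p + 2) / (m + 2)) * (bernsteinPolynomial ℝ (m + 2) (p + 2)).eval t -
        2 * x * ((p + 1) / (m + 1)) * (bernsteinPolynomial ℝ (m + 1) (p + 1)).eval t +
        x ^ 2 * (bernsteinPolynomial ℝ m p).eval t := by
    intro t
    have h1 := mul_eval_bernsteinPolynomial m p t
    have h2 := mul_eval_bernsteinPolynomial (m + 1) (p + 1) t
    push_cast [add_assoc, one_add_one_eq_two] at h2
    linear_combination (t - 2 * x) * h1 + (p + 1) / (m + 1) * h2
  have hint : ∀ (c : ℝ) (a b : ℕ),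
      IntervalIntegrable (fun t => c * (bernsteinPolynomial ℝ a b).eval t) volume 0 1 :=
    fun c a b => Continuous.intervalIntegrable (by fun_prop) _ _
  simp only [hexpand]
  rw [intervalIntegral.integral_add ((hint _ _ _).sub (hint _ _ _)) (hint _ _ _),
    intervalIntegral.integral_sub (hint _ _ _) (hint _ _ _)]
  simp only [intervalIntegral.integral_const_mul, integral_bernsteinPolynomial hp,
    integral_bernsteinPolynomial (Nat.add_le_add_right hp _)]
  push_cast
  field_simp
  ring

theorem tendsto_natCast_add_div_add {p : ℕ → ℕ} {x : ℝ}
    (hx : Tendsto (fun m : ℕ => (p m : ℝ) / m) atTop (𝓝 x)) (a b : ℝ) :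
    Tendsto (fun m : ℕ => ((p m : ℝ) + a) / (m + b)) atTop (𝓝 x) := by
  have hinv := tendsto_inv_atTop_nhds_zero_nat (𝕜 := ℝ)
  have h := (hx.add (hinv.const_mul a)).div ((hinv.const_mul b).const_add 1) (by simp)
  simp only [mul_zero, add_zero, div_one] at h
  refine h.congr' ?_
  filter_upwards [eventually_gt_atTop 0] with m hm
  have hm0 : (m : ℝ) ≠ 0 := by positivity
  rw [Pi.div_apply, ← mul_div_mul_right ((p m : ℝ) / m + a * (m : ℝ)⁻¹) _ hm0]
  congr 1 <;> field_simp

theorem tendsto_integral_bernsteinPolynomial_mul {p : ℕ → ℕ} (hp : ∀ᶠ m in atTop, p m ≤ m) {x : ℝ}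
    (hx : Tendsto (fun m : ℕ => (p m : ℝ) / m) atTop (𝓝 x)) {f : ℝ → ℝ} (hf : Continuous f)
    {M : ℝ} (hM : ∀ t, |f t| ≤ M) :
    Tendsto (fun m : ℕ => ((m : ℝ) + 1) *
      ∫ t in (0 : ℝ)..1, (bernsteinPolynomial ℝ m (p m)).eval t * f t) atTop (𝓝 (f x)) := by
  have hmoment := (((tendsto_natCast_add_div_add hx 1 2).mul
    (tendsto_natCast_add_div_add hx 2 3)).sub
    ((tendsto_natCast_add_div_add hx 1 2).const_mul (2 * x))).add_const (x ^ 2)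
  rw [show x * x - 2 * x * x + x ^ 2 = 0 by ring] at hmoment
  have h := tendsto_integral_mul_of_tendsto_integral_mul_dist_sq (l := atTop) (x := x)
    (μ := volume.restrict (Ioc 0 1))
    (φ := fun (m : ℕ) t => ((m : ℝ) + 1) * (bernsteinPolynomial ℝ m (p m)).eval t)
    (fun m => ae_restrict_of_forall_mem measurableSet_Ioc fun t ht =>
      mul_nonneg (by positivity) (eval_bernsteinPolynomial_nonneg m (p m) (Ioc_subset_Icc_self ht)))
    (fun m => Continuous.integrableOn_Ioc (by fun_prop)) ?_
    (fun m => Continuous.integrableOn_Ioc (by fun_prop)) ?_ hM hf.aestronglyMeasurable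
    hf.continuousAt
  · simpa only [mul_assoc, intervalIntegral.integral_of_le zero_le_one,
      integral_const_mul] using h
  · refine tendsto_const_nhds.congr' ?_
    filter_upwards [hp] with m hm
    rw [integral_const_mul, ← intervalIntegral.integral_of_le zero_le_one,
      integral_bernsteinPolynomial hm, mul_one_div_cancel (by positivity)]
  · refine hmoment.congr' ?_
    filter_upwards [hp] with m hm
    simp only [mul_assoc, integral_const_mul, Real.dist_eq, sq_abs]
    rw [← intervalIntegral.integral_of_le zero_le_one, integral_bernsteinPolynomial_mul_sq hm]
    simp only [mul_assoc]

theorem excludedProb_succ_eq_zero {m p : ℕ} (h : m < p) : excludedProb (m + 1) p = 0 := by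
  simp [excludedProb_succ_eq_integral, bernsteinPolynomial.eq_zero_of_lt ℝ h]

theorem tendsto_mul_excludedProb_of_eventually_le {p : ℕ → ℕ} (hp : ∀ᶠ m in atTop, p m ≤ m) {x : ℝ}
    (hx : Tendsto (fun m : ℕ => (p m : ℝ) / m) atTop (𝓝 x)) :
    Tendsto (fun m : ℕ => m * excludedProb (m + 1) (p m)) atTop (𝓝 (excludedDensity x)) := by
  have h := (tendsto_natCast_div_add_atTop (1 : ℝ)).mul
    (tendsto_integral_bernsteinPolynomial_mul hp hx continuous_excludedDensity
      abs_excludedDensity_le)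
  rw [one_mul] at h
  refine h.congr fun m => ?_
  rw [← excludedProb_succ_eq_integral]
  field_simp

theorem tendsto_mul_excludedProb {p : ℕ → ℕ} {x : ℝ} (hx1 : x ≤ 1)
    (hx : Tendsto (fun m : ℕ => (p m : ℝ) / m) atTop (𝓝 x)) :
    Tendsto (fun m : ℕ => m * excludedProb (m + 1) (p m)) atTop (𝓝 (excludedDensity x)) := by
  rcases hx1.lt_or_eq with hlt | rfl
  · refine tendsto_mul_excludedProb_of_eventually_le ?_ hx
    filter_upwards [hx.eventually_lt_const hlt, eventually_gt_atTop 0] with m hm hm0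
    rw [div_lt_one (by positivity)] at hm
    exact_mod_cast hm.le
  · have hmin : Tendsto (fun m : ℕ => ((min (p m) m : ℕ) : ℝ) / m) atTop (𝓝 1) := by
      refine (min_self (1 : ℝ) ▸ hx.min tendsto_const_nhds).congr' ?_
      filter_upwards [eventually_gt_atTop 0] with m hm
      rw [Nat.cast_min, ← min_div_div_right m.cast_nonneg, div_self (by positivity)]
    have hbound := tendsto_mul_excludedProb_of_eventually_le
      (Eventually.of_forall fun m => min_le_right (p m) m) hmin
    rw [excludedDensity_one] at hbound ⊢
    refine squeeze_zero (fun m => mul_nonneg m.cast_nonneg (excludedProb_nonneg _ _))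
      (fun m => mul_le_mul_of_nonneg_left ?_ m.cast_nonneg) hbound
    rcases le_or_gt (p m) m with hle | hgt
    · rw [min_eq_left hle]
    · exact (excludedProb_succ_eq_zero hgt).le.trans (excludedProb_nonneg _ _)

theorem mul_excludedProb_succ_le (m p : ℕ) : m * excludedProb (m + 1) p ≤ Real.pi / 2 := by
  rcases le_or_gt p m with hp | hp
  · have hcont := continuous_excludedDensity
    have hmono : excludedProb (m + 1) p ≤ 1 / (m + 1) * (Real.pi / 2) := by
      rw [excludedProb_succ_eq_integral, ← integral_bernsteinPolynomial hp,
        ← intervalIntegral.integral_mul_const]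
      exact intervalIntegral.integral_mono_on zero_le_one
        (Continuous.intervalIntegrable (by fun_prop) _ _)
        (Continuous.intervalIntegrable (by fun_prop) _ _) fun t ht =>
        mul_le_mul_of_nonneg_left ((le_abs_self _).trans (abs_excludedDensity_le t))
          (eval_bernsteinPolynomial_nonneg m p ht)
    calc m * excludedProb (m + 1) p ≤ m * (1 / (m + 1) * (Real.pi / 2)) := by gcongr
      _ = m / (m + 1) * (Real.pi / 2) := by ring
      _ ≤ 1 * (Real.pi / 2) := by
        gcongr
        exact div_le_one_of_le₀ (by linarith) (by positivity)
      _ = Real.pi / 2 := one_mul _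
  · rw [excludedProb_succ_eq_zero hp, mul_zero]
    positivity

/-! ### Riemann sums -/

theorem abs_integral_sub_integral_le {f : ℝ → ℝ} {C : ℝ} (hf : Measurable f) (hC : ∀ t, |f t| ≤ C)
    (a b c : ℝ) : |(∫ t in a..b, f t) - ∫ t in a..c, f t| ≤ C * |b - c| := by
  have hint : ∀ u v, IntervalIntegrable f volume u v := fun u v =>
    intervalIntegrable_const (c := C) |>.mono_fun' hf.aestronglyMeasurable (ae_of_all _ hC)
  rw [intervalIntegral.integral_interval_sub_left (hint _ _) (hint _ _), ← Real.norm_eq_abs]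
  exact intervalIntegral.norm_integral_le_of_norm_le_const fun t _ => hC t

theorem integral_natFloor (a : ℕ → ℝ) (K : ℕ) :
    ∫ t in (0 : ℝ)..K, a ⌊t⌋₊ = ∑ p ∈ Finset.range K, a p := by
  have hconst : ∀ k : ℕ, EqOn (fun t : ℝ => a ⌊t⌋₊) (fun _ => a k) (Ioo k (k + 1 : ℕ)) :=
    fun k t ht => congrArg a (Nat.floor_eq_on_Ico k t ⟨ht.1.le, by simpa using ht.2⟩)
  rw [← Nat.cast_zero, ← intervalIntegral.sum_integral_adjacent_intervals
    (a := fun k : ℕ => (k : ℝ))]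
  · refine Finset.sum_congr rfl fun k _ => ?_
    rw [intervalIntegral.integral_congr_Ioo_of_le (by simp) (hconst k)]
    simp
  · intro k _
    exact intervalIntegrable_const.congr_uIoo (uIoo_of_le (by simp : (k : ℝ) ≤ (k + 1 : ℕ)) ▸
      (hconst k).symm)

theorem integral_mul_natFloor_mul (a : ℕ → ℝ) (K : ℕ) {m : ℝ} (hm : m ≠ 0) :
    ∫ t in (0 : ℝ)..K / m, m * a ⌊m * t⌋₊ = ∑ p ∈ Finset.range K, a p := by
  rw [intervalIntegral.integral_const_mul, ← smul_eq_mul,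
    intervalIntegral.smul_integral_comp_mul_left (fun t => a ⌊t⌋₊), mul_zero,
    mul_div_cancel₀ _ hm, integral_natFloor]

theorem tendsto_sum_range_of_tendsto_mul {a : ℕ → ℕ → ℝ} {f : ℝ → ℝ} {x C : ℝ}
    (hlim : ∀ t ∈ Ioc 0 x, ∀ p : ℕ → ℕ, Tendsto (fun m => (p m : ℝ) / m) atTop (𝓝 t) →
      Tendsto (fun m => m * a m (p m)) atTop (𝓝 (f t)))
    (hC : ∀ m p, |m * a m p| ≤ C) {K : ℕ → ℕ}
    (hK : Tendsto (fun m => (K m : ℝ) / m) atTop (𝓝 x)) :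
    Tendsto (fun m => ∑ p ∈ Finset.range (K m), a m p) atTop (𝓝 (∫ t in (0 : ℝ)..x, f t)) := by
  have hx : 0 ≤ x := ge_of_tendsto' hK fun m => by positivity
  have hmeas : ∀ m : ℕ, Measurable fun t : ℝ => (m : ℝ) * a m ⌊m * t⌋₊ := fun m =>
    ((measurable_of_countable (a m)).comp
      (Nat.measurable_floor.comp (measurable_const_mul _))).const_mul _
  have hfixed : Tendsto (fun m : ℕ => ∫ t in (0 : ℝ)..x, m * a m ⌊m * t⌋₊) atTop
      (𝓝 (∫ t in (0 : ℝ)..x, f t)) := by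
    refine intervalIntegral.tendsto_integral_filter_of_dominated_convergence (fun _ => C)
      (Eventually.of_forall fun m => (hmeas m).aestronglyMeasurable)
      (Eventually.of_forall fun m => ae_of_all _ fun t _ => hC m _) intervalIntegrable_const
      (ae_of_all _ fun t ht => ?_)
    rw [uIoc_of_le hx] at ht
    refine hlim t ht _ ?_
    simp only [mul_comm _ t]
    exact (tendsto_nat_floor_mul_div_atTop ht.1.le).comp tendsto_natCast_atTop_atTop
  have hendpoint : Tendsto (fun m : ℕ => (∫ t in (0 : ℝ)..K m / m, m * a m ⌊m * t⌋₊) -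
      ∫ t in (0 : ℝ)..x, m * a m ⌊m * t⌋₊) atTop (𝓝 0) := by
    refine squeeze_zero_norm (fun m => abs_integral_sub_integral_le (hmeas m)
      (fun t => hC m _) 0 _ x) ?_
    simpa using ((hK.sub_const x).abs).const_mul C
  refine (zero_add (∫ t in (0 : ℝ)..x, f t) ▸ hendpoint.add hfixed).congr' ?_
  filter_upwards [eventually_ne_atTop 0] with m hm
  rw [sub_add_cancel, integral_mul_natFloor_mul _ _ (Nat.cast_ne_zero.2 hm)]

theorem tendsto_sum_range_excludedProb {x : ℝ} (hx : x ≤ 1) {K : ℕ → ℕ}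
    (hK : Tendsto (fun m : ℕ => (K m : ℝ) / m) atTop (𝓝 x)) :
    Tendsto (fun m : ℕ => ∑ p ∈ Finset.range (K m), excludedProb (m + 1) p) atTop
      (𝓝 (∫ t in (0 : ℝ)..x, excludedDensity t)) :=
  tendsto_sum_range_of_tendsto_mul
    (fun _ ht _ => tendsto_mul_excludedProb (ht.2.trans hx))
    (fun m p => (abs_of_nonneg (mul_nonneg m.cast_nonneg (excludedProb_nonneg _ _))).trans_le
      (mul_excludedProb_succ_le m p)) hK

theorem sum_filter_range_succ_excludedProb (m : ℕ) (P : ℕ → Prop) [DecidablePred P] {K : ℕ}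
    (hP : ∀ p, P p ↔ p < K) :
    ∑ p ∈ Finset.range (m + 1) with P p, excludedProb (m + 1) p =
      ∑ p ∈ Finset.range K, excludedProb (m + 1) p := by
  refine Finset.sum_subset (fun p hp => ?_) fun p hp hp' => ?_
  · exact Finset.mem_range.2 ((hP p).1 (Finset.mem_filter.1 hp).2)
  · refine excludedProb_succ_eq_zero (not_le.1 fun h => hp' ?_)
    exact Finset.mem_filter.2 ⟨Finset.mem_range_succ_iff.2 h, (hP p).2 (Finset.mem_range.1 hp)⟩

theorem tendsto_sum_excludedProb_le {x : ℝ} (hx : x ∈ Icc 0 1) :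
    Tendsto (fun n : ℕ => ∑ p ∈ Finset.range n with ((p : ℕ) : ℝ) ≤ ((n : ℝ) - 1) * x,
      excludedProb n p) atTop (𝓝 (∫ t in (0 : ℝ)..x, excludedDensity t)) := by
  rw [← tendsto_add_atTop_iff_nat 1]
  have hK := tendsto_natCast_add_div_add (((tendsto_nat_floor_mul_div_atTop hx.1).comp
    tendsto_natCast_atTop_atTop)) 1 0
  refine (tendsto_sum_range_excludedProb hx.2 (K := fun m => ⌊x * m⌋₊ + 1)
    (by simpa using hK)).congr fun m => (sum_filter_range_succ_excludedProb m _ fun p => ?_).symm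
  rw [Nat.lt_succ_iff, Nat.le_floor_iff (mul_nonneg hx.1 m.cast_nonneg), Nat.cast_add_one,
    add_sub_cancel_right, mul_comm]

theorem tendsto_sum_excludedProb_lt_half :
    Tendsto (fun n : ℕ => ∑ p ∈ Finset.range n with ((p : ℕ) : ℝ) < ((n : ℝ) - 1) / 2,
      excludedProb n p) atTop (𝓝 (∫ t in (0 : ℝ)..1 / 2, excludedDensity t)) := by
  rw [← tendsto_add_atTop_iff_nat 1]
  have hK := (tendsto_nat_ceil_mul_div_atTop (one_half_pos (α := ℝ)).le).comp
    (tendsto_natCast_atTop_atTop (R := ℝ))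
  refine (tendsto_sum_range_excludedProb one_half_lt_one.le hK).congr
    fun m => (sum_filter_range_succ_excludedProb m _ fun p => ?_).symm
  rw [Nat.lt_ceil, Nat.cast_add_one, add_sub_cancel_right, one_div_mul_eq_div]

theorem integral_excludedDensity_half :
    ∫ t in (0 : ℝ)..1 / 2, excludedDensity t = Real.pi / 4 := by
  have hconst : EqOn excludedDensity (fun _ => Real.pi / 2) (Ioo 0 (1 / 2)) := fun t ht =>
    if_pos ht.2
  rw [intervalIntegral.integral_congr_Ioo_of_le (by norm_num) hconst,
    intervalIntegral.integral_const, smul_eq_mul]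
  ring

theorem mainTheorem8 :
    -- the rescaled probabilities converge to the density, at every point of `[0, 1]`
    (∀ x ∈ Set.Icc (0 : ℝ) 1, ∀ p : ℕ → ℕ,
      Filter.Tendsto (fun n : ℕ => (p n : ℝ) / ((n : ℝ) - 1)) Filter.atTop (nhds x) →
      Filter.Tendsto (fun n : ℕ => ((n : ℝ) - 1) * excludedProb n (p n)) Filter.atTop
        (nhds (excludedDensity x))) ∧
    -- the rescaled cumulative distribution functions converge accordingly
    (∀ x ∈ Set.Icc (0 : ℝ) 1,
      Filter.Tendsto
        (fun n : ℕ => ∑ p ∈ (Finset.range n).filter (fun p : ℕ => (p : ℝ) ≤ ((n : ℝ) - 1) * x),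
          excludedProb n p)
        Filter.atTop (nhds (∫ t in (0 : ℝ)..x, excludedDensity t))) ∧
    -- the probability that fewer than half of the other pairs are excluded tends to `π / 4`
    Filter.Tendsto
      (fun n : ℕ => ∑ p ∈ (Finset.range n).filter (fun p : ℕ => (p : ℝ) < ((n : ℝ) - 1) / 2),
        excludedProb n p)
      Filter.atTop (nhds (Real.pi / 4)) := by
  refine ⟨fun x hx p hp => ?_, fun x hx => tendsto_sum_excludedProb_le hx,
    integral_excludedDensity_half ▸ tendsto_sum_excludedProb_lt_half⟩
  rw [← Filter.tendsto_add_atTop_iff_nat 1] at hp ⊢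
  simp only [Nat.cast_add_one, add_sub_cancel_right] at hp ⊢
  exact tendsto_mul_excludedProb hx.2 hp
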